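/- Let $\alpha=(\alpha_n)_{n\ge1}$ be a positive, strictly increasing sequence of real numbers with $\alpha_n\to\infty$, and let $(s_k)_{k\ge1}\subset(1,\infty)$ be strictly increasing with $s_k\to\infty$. Put $v_k(n):=s_k^{-\alpha_n}$ and let $c_0(v_k)$ be the Banach space of all complex sequences $x=(x_n)_{n\ge1}$ with $v_k(n)x_n\to0$, normed by $\sup_n v_k(n)|x_n|$. Let $E_\alpha:=\operatorname{ind}_k c_0(v_k)$, i.e. the increasing union $\bigcup_k c_0(v_k)$ with the finest locally convex topology for which all inclusions $c_0(v_k)\hookrightarrow E_\alpha$ are continuous. Let $\mathsf C\in\mathcal L(E_\alpha)$ be the Cesàro operator $(\mathsf Cx)_n=\frac1n\sum_{i=1}^n x_i$. For a continuous linear operator $T$ on a locally convex Hausdorff space $X$ let $\rho(T)$ be the set of all $\lambda\in\mathbb C$ for which $R(\lambda,T):=(\lambda I-T)^{-1}$ exists in $\mathcal L(X)$, let $\sigma(T;X):=\mathbb C\setminus\rho(T)$, let $\sigma_{pt}(T;X)$ be the set of all $\lambda$ for which $\lambda I-T$ is not injective, let $\rho^*(T)$ be the set of all $\lambda$ for which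 there is $\delta>0$ such that $B(\lambda,\delta):=\{\mu\in\mathbb C:|\mu-\lambda|<\delta\}\subset\rho(T)$ and $\{R(\mu,T):\mu\in B(\lambda,\delta)\}$ is equicontinuous in $\mathcal L(X)$, and let $\sigma^*(T;X):=\mathbb C\setminus\rho^*(T)$. If $E_\alpha$ is a nuclear space, then (i) $\sigma(\mathsf C;E_\alpha)=\sigma_{pt}(\mathsf C;E_\alpha)=\{\frac1n:n\in\mathbb N,\ n\ge1\}$, and (ii) $\sigma^*(\mathsf C;E_\alpha)=\sigma(\mathsf C;E_\alpha)\cup\{0\}=\{0\}\cup\{\frac1n:n\in\mathbb N,\ n\ge1\}$. -/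

import Mathlib

open Filter Topology

noncomputable section

namespace CesaroSpec

/-! ### Weighted null sequences

Sequences are indexed from `0`: the index `n : ℕ` stands for the classical index `n + 1`. -/

/-- The vector space `c₀(w)` of all complex sequences `x` with `w n * x n → 0`. -/
def c0Submodule (w : ℕ → ℝ) : Submodule ℂ (ℕ → ℂ) where
  carrier := {x | Tendsto (fun n => (w n : ℂ) * x n) atTop (𝓝 0)}
  zero_mem' := by simp
  add_mem' := by
    intro x y hx hy
    simpa [mul_add] using Tendsto.add hx hy
  smul_mem' := by
    intro c x hx
    have h := Tendsto.const_mul c hx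
    simpa [mul_left_comm] using h

/-- `c₀(w)` as a type of its own, so that it carries the weighted sup-norm and not the topology of
coordinatewise convergence. -/
def C0 (w : ℕ → ℝ) : Type := c0Submodule w

instance (w : ℕ → ℝ) : AddCommGroup (C0 w) := inferInstanceAs (AddCommGroup (c0Submodule w))

instance (w : ℕ → ℝ) : Module ℂ (C0 w) := inferInstanceAs (Module ℂ (c0Submodule w))

theorem C0.bddAbove {w : ℕ → ℝ} (x : C0 w) :
    BddAbove (Set.range fun n => ‖(w n : ℂ) * x.1 n‖) :=
  (Tendsto.norm x.2).bddAbove_range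

/-- The norm `q(x) = supₙ w(n) |x(n)|` of `c₀(w)` (for a positive weight `w`). -/
def c0Norm (w : ℕ → ℝ) : Seminorm ℂ (C0 w) :=
  Seminorm.of (fun x => ⨆ n, ‖(w n : ℂ) * x.1 n‖)
    (fun x y => ciSup_le fun n => by
      have h : (w n : ℂ) * (x + y).1 n = (w n : ℂ) * x.1 n + (w n : ℂ) * y.1 n :=
        mul_add _ _ _
      rw [h]
      exact (norm_add_le _ _).trans
        (add_le_add (le_ciSup x.bddAbove n) (le_ciSup y.bddAbove n)))
    (fun c x => by
      rw [Real.mul_iSup_of_nonneg (norm_nonneg c)]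
      refine iSup_congr fun n => ?_
      have h : (w n : ℂ) * (c • x).1 n = c * ((w n : ℂ) * x.1 n) :=
        mul_left_comm _ _ _
      rw [h, norm_mul])

instance (w : ℕ → ℝ) : SeminormedAddCommGroup (C0 w) :=
  (c0Norm w).toAddGroupSeminorm.toSeminormedAddCommGroup

instance (w : ℕ → ℝ) : NormedSpace ℂ (C0 w) where
  norm_smul_le c x := le_of_eq (map_smul_eq_mul (c0Norm w) c x)

theorem C0.norm_def {w : ℕ → ℝ} (x : C0 w) : ‖x‖ = ⨆ n, ‖(w n : ℂ) * x.1 n‖ := rfl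

/-! ### The space `E_α` -/

/-- The weights `v_k(n) = s_k ^ (-α_n)`. -/
def weight (α s : ℕ → ℝ) (k n : ℕ) : ℝ := s k ^ (-α n)

/-- The vector space underlying `E_α`: the span of the subspaces `c₀(v_k)` of `ℂ^ℕ`. As these
increase with `k`, it is their union, see `mem_eSubmodule`. -/
def eSubmodule (α s : ℕ → ℝ) : Submodule ℂ (ℕ → ℂ) := ⨆ k, c0Submodule (weight α s k)

/-- The space `E_α = ind_k c₀(v_k)`, as a type of its own, so that it carries the inductive limit
topology and not the topology of coordinatewise convergence. -/
def E (α s : ℕ → ℝ) : Type := eSubmodule α s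

instance (α s : ℕ → ℝ) : AddCommGroup (E α s) := inferInstanceAs (AddCommGroup (eSubmodule α s))

instance (α s : ℕ → ℝ) : Module ℂ (E α s) := inferInstanceAs (Module ℂ (eSubmodule α s))

/-- The inclusion `c₀(v_k) → E_α`. -/
def incl (α s : ℕ → ℝ) (k : ℕ) : C0 (weight α s k) →ₗ[ℂ] E α s :=
  Submodule.inclusion (le_iSup (fun k => c0Submodule (weight α s k)) k)

/-- The finest locally convex (vector space) topology on `X` making all the linear maps `ι k`
continuous. In Mathlib's order `≤` on topologies, finer means smaller. -/
@[reducible]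
def indTopology {X : Type*} [AddCommGroup X] [Module ℂ X] {Y : ℕ → Type*}
    [∀ k, AddCommGroup (Y k)] [∀ k, Module ℂ (Y k)] [∀ k, TopologicalSpace (Y k)]
    (ι : ∀ k, Y k →ₗ[ℂ] X) : TopologicalSpace X :=
  sInf {t : TopologicalSpace X |
    @IsTopologicalAddGroup X t _ ∧ @ContinuousSMul ℂ X _ _ t ∧
    @LocallyConvexSpace ℝ X _ _ _ (Module.complexToReal X) t ∧ ∀ k, Continuous[_, t] (ι k)}

instance (α s : ℕ → ℝ) : TopologicalSpace (E α s) := indTopology (incl α s)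

instance (α s : ℕ → ℝ) : IsTopologicalAddGroup (E α s) :=
  topologicalAddGroup_sInf fun _ ht => ht.1

instance (α s : ℕ → ℝ) : ContinuousSMul ℂ (E α s) :=
  continuousSMul_sInf fun _ ht => ht.2.1

instance (α s : ℕ → ℝ) : LocallyConvexSpace ℝ (E α s) :=
  .sInf fun _ ht => ht.2.2.1

theorem continuous_incl (α s : ℕ → ℝ) (k : ℕ) : Continuous (incl α s k) :=
  continuous_sInf_rng.2 fun _ ht => ht.2.2.2 k

/-- A linear map from `E_α` to a locally convex space is continuous as soon as it is so on every
step. -/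
theorem continuous_of_steps {α s : ℕ → ℝ} {F : Type*} [AddCommGroup F] [Module ℂ F]
    [TopologicalSpace F] [IsTopologicalAddGroup F] [ContinuousSMul ℂ F] [LocallyConvexSpace ℝ F]
    (T : E α s →ₗ[ℂ] F) (hT : ∀ k, Continuous fun x => T (incl α s k x)) : Continuous T := by
  rw [continuous_iff_le_induced]
  refine sInf_le ⟨topologicalAddGroup_induced T, continuousSMul_induced T,
    LocallyConvexSpace.induced (T.restrictScalars ℝ), fun k => continuous_induced_rng.2 (hT k)⟩

/-- For weights `v_k` that decrease in `k`, the space `E_α` is the union of the `c₀(v_k)`. -/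
theorem mem_eSubmodule {α s : ℕ → ℝ} (hα : ∀ n, 0 < α n) (hs : ∀ k, 1 < s k)
    (hsm : StrictMono s) (x : ℕ → ℂ) :
    x ∈ eSubmodule α s ↔
      ∃ k, Tendsto (fun n => ((weight α s k n : ℝ) : ℂ) * x n) atTop (𝓝 0) := by
  have hw : ∀ k n, 0 ≤ weight α s k n := fun k n => Real.rpow_nonneg (by linarith [hs k]) _
  have hmono : Monotone fun k => c0Submodule (weight α s k) := by
    intro k l hkl x hx
    refine squeeze_zero_norm (fun n => ?_) (tendsto_zero_iff_norm_tendsto_zero.1 hx)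
    simp only [norm_mul, Complex.norm_real, Real.norm_of_nonneg (hw _ _)]
    refine mul_le_mul_of_nonneg_right ?_ (norm_nonneg _)
    exact Real.rpow_le_rpow_of_nonpos (by linarith [hs k]) (hsm.monotone hkl) (by linarith [hα n])
  exact Submodule.mem_iSup_of_directed _ hmono.directed_le

/-- The inductive limit topology of `E_α` is Hausdorff. -/
theorem t2Space_E {α s : ℕ → ℝ} (hs : ∀ k, 1 < s k) : T2Space (E α s) := by
  have hw : ∀ k n, 0 < weight α s k n := fun k n => Real.rpow_pos_of_pos (by linarith [hs k]) _
  let ev : ℕ → E α s →ₗ[ℂ] ℂ := fun n => (LinearMap.proj n).comp (eSubmodule α s).subtype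
  have hev : ∀ n, Continuous (ev n) := by
    intro n
    refine continuous_of_steps (ev n) fun k => ?_
    refine AddMonoidHomClass.continuous_of_bound ((ev n).comp (incl α s k))
      (weight α s k n)⁻¹ fun x => ?_
    have h1 : ‖((weight α s k n : ℝ) : ℂ) * x.1 n‖ ≤ ‖x‖ := le_ciSup x.bddAbove n
    rw [norm_mul, Complex.norm_real, Real.norm_of_nonneg (hw k n).le] at h1
    rw [inv_mul_eq_div, le_div_iff₀' (hw k n)]
    exact h1
  refine T2Space.of_injective_continuous (f := fun (x : E α s) (n : ℕ) => ev n x) ?_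
    (continuous_pi hev)
  exact fun x y h => Subtype.ext h

/-! ### The Cesàro operator -/

/-- The Cesàro operator on `ℂ^ℕ`. -/
def cesaroSeq : (ℕ → ℂ) →ₗ[ℂ] (ℕ → ℂ) where
  toFun x n := (∑ i ∈ Finset.range (n + 1), x i) / ((n : ℂ) + 1)
  map_add' x y := by
    ext n
    simp [Finset.sum_add_distrib, add_div]
  map_smul' c x := by
    ext n
    simp [← Finset.mul_sum, mul_div_assoc]

theorem norm_cesaroSeq_le {w : ℕ → ℝ} (hw : ∀ n, 0 ≤ w n) (hanti : Antitone w) (x : ℕ → ℂ)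
    (n : ℕ) : ‖(w n : ℂ) * cesaroSeq x n‖ ≤
      ((n + 1 : ℕ) : ℝ)⁻¹ * ∑ i ∈ Finset.range (n + 1), ‖(w i : ℂ) * x i‖ := by
  have h1 : (w n : ℂ) * cesaroSeq x n =
      (((n + 1 : ℕ) : ℝ)⁻¹ : ℝ) * ∑ i ∈ Finset.range (n + 1), (w n : ℂ) * x i := by
    simp only [cesaroSeq, LinearMap.coe_mk, AddHom.coe_mk, ← Finset.mul_sum]
    push_cast
    ring
  rw [h1, norm_mul, Complex.norm_real, Real.norm_of_nonneg (by positivity)]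
  refine mul_le_mul_of_nonneg_left ((norm_sum_le _ _).trans (Finset.sum_le_sum fun i hi => ?_))
    (by positivity)
  simp only [norm_mul, Complex.norm_real, Real.norm_of_nonneg (hw _)]
  exact mul_le_mul_of_nonneg_right (hanti (by simp at hi; omega)) (norm_nonneg _)

theorem cesaroSeq_mem_c0 {w : ℕ → ℝ} (hw : ∀ n, 0 ≤ w n) (hanti : Antitone w) {x : ℕ → ℂ}
    (hx : x ∈ c0Submodule w) : cesaroSeq x ∈ c0Submodule w := by
  refine squeeze_zero_norm (norm_cesaroSeq_le hw hanti x) ?_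
  exact (tendsto_add_atTop_iff_nat 1).2
    (Tendsto.cesaro (tendsto_zero_iff_norm_tendsto_zero.1 hx))

theorem weight_antitone {α s : ℕ → ℝ} (hα : StrictMono α) (hs : ∀ k, 1 < s k) (k : ℕ) :
    Antitone (weight α s k) := fun _ _ h =>
  Real.rpow_le_rpow_of_exponent_le (hs k).le (neg_le_neg (hα.monotone h))

theorem weight_nonneg {α s : ℕ → ℝ} (hs : ∀ k, 1 < s k) (k n : ℕ) : 0 ≤ weight α s k n :=
  Real.rpow_nonneg (by linarith [hs k]) _

theorem cesaroSeq_mem_E {α s : ℕ → ℝ} (hα : StrictMono α) (hs : ∀ k, 1 < s k) :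
    ∀ x ∈ eSubmodule α s, cesaroSeq x ∈ eSubmodule α s := by
  have h : eSubmodule α s ≤ (eSubmodule α s).comap cesaroSeq := iSup_le fun k x hx =>
    (le_iSup (fun k => c0Submodule (weight α s k)) k)
      (cesaroSeq_mem_c0 (weight_nonneg hs k) (weight_antitone hα hs k) hx)
  exact h

/-- The restriction of the Cesàro operator to `E_α`, as a linear map. -/
def cesaroLin (α s : ℕ → ℝ) (hα : StrictMono α) (hs : ∀ k, 1 < s k) : E α s →ₗ[ℂ] E α s :=
  cesaroSeq.restrict (cesaroSeq_mem_E hα hs)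

theorem continuous_cesaroLin (α s : ℕ → ℝ) (hα : StrictMono α) (hs : ∀ k, 1 < s k) :
    Continuous (cesaroLin α s hα hs) := by
  refine continuous_of_steps _ fun k => ?_
  let T : C0 (weight α s k) →ₗ[ℂ] C0 (weight α s k) :=
    cesaroSeq.restrict fun x hx =>
      cesaroSeq_mem_c0 (weight_nonneg hs k) (weight_antitone hα hs k) hx
  have hT : Continuous T := by
    refine AddMonoidHomClass.continuous_of_bound T 1 fun x => ?_
    rw [one_mul]
    refine ciSup_le fun n => ?_
    refine (norm_cesaroSeq_le (weight_nonneg hs k) (weight_antitone hα hs k) x.1 n).trans ?_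
    rw [inv_mul_le_iff₀ (by positivity)]
    have h := Finset.sum_le_card_nsmul (Finset.range (n + 1))
      (fun i => ‖((weight α s k i : ℝ) : ℂ) * x.1 i‖) ‖x‖ fun i _ => le_ciSup x.bddAbove i
    simpa using h
  exact (continuous_incl α s k).comp hT

/-- The Cesàro operator on `E_α`, as an element of `𝓛(E_α)`. -/
def cesaro (α s : ℕ → ℝ) (hα : StrictMono α) (hs : ∀ k, 1 < s k) : E α s →L[ℂ] E α s :=
  ⟨cesaroLin α s hα hs, continuous_cesaroLin α s hα hs⟩

/-! ### Nuclear spaces -/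

/-- A continuous linear map between normed spaces is nuclear if it has a representation
`T x = ∑ⱼ fⱼ(x) yⱼ` with `∑ⱼ ‖fⱼ‖ ‖yⱼ‖ < ∞`. -/
def IsNuclearMap {X Y : Type*} [NormedAddCommGroup X] [NormedSpace ℂ X]
    [NormedAddCommGroup Y] [NormedSpace ℂ Y] (T : X →L[ℂ] Y) : Prop :=
  ∃ (f : ℕ → X →L[ℂ] ℂ) (y : ℕ → Y),
    Summable (fun j => ‖f j‖ * ‖y j‖) ∧ ∀ x, HasSum (fun j => f j x • y j) (T x)

/-- The vector space `X` equipped with the seminorm `p`. -/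
def WithSeminorm {X : Type*} [AddCommGroup X] [Module ℂ X] (_p : Seminorm ℂ X) : Type _ := X

instance {X : Type*} [AddCommGroup X] [Module ℂ X] (p : Seminorm ℂ X) :
    SeminormedAddCommGroup (WithSeminorm p) :=
  p.toAddGroupSeminorm.toSeminormedAddCommGroup

instance {X : Type*} [AddCommGroup X] [Module ℂ X] (p : Seminorm ℂ X) :
    Module ℂ (WithSeminorm p) := inferInstanceAs (Module ℂ X)

instance {X : Type*} [AddCommGroup X] [Module ℂ X] (p : Seminorm ℂ X) :
    NormedSpace ℂ (WithSeminorm p) where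
  norm_smul_le c x := le_of_eq (map_smul_eq_mul p c x)

/-- The local Banach space of the seminorm `p`: the (Hausdorff) completion of `(X, p)`, i.e. the
completion of `X / ker p` in the norm induced by `p`. -/
abbrev LocalBanach {X : Type*} [AddCommGroup X] [Module ℂ X] (p : Seminorm ℂ X) : Type _ :=
  UniformSpace.Completion (WithSeminorm p)

/-- The class of `x` in the local Banach space of `p`. -/
def toLocal {X : Type*} [AddCommGroup X] [Module ℂ X] (p : Seminorm ℂ X) (x : X) : LocalBanach p :=
  UniformSpace.Completion.coe' (α := WithSeminorm p) x

/-- A locally convex space is nuclear if for every continuous seminorm `p` there is a continuous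
seminorm `q ≥ p` such that the canonical map from the local Banach space of `q` to that of `p`
(the continuous linear map sending the class of `x` to the class of `x`) is nuclear. -/
def IsNuclearSpace (X : Type*) [AddCommGroup X] [Module ℂ X] [TopologicalSpace X] : Prop :=
  ∀ p : Seminorm ℂ X, Continuous p → ∃ q : Seminorm ℂ X, Continuous q ∧ p ≤ q ∧
    ∃ T : LocalBanach q →L[ℂ] LocalBanach p,
      (∀ x : X, T (toLocal q x) = toLocal p x) ∧ IsNuclearMap T

/-! ### Spectra

For `T ∈ 𝓛(X)`, Mathlib's `spectrum ℂ T` is the set of all `z` for which `z I - T` has no inverse in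
the algebra `𝓛(X)`, `resolventSet ℂ T` is its complement, and `resolvent T z` is the inverse of
`z I - T` for `z` in the resolvent set. -/

section Spectra

variable {X : Type*} [AddCommGroup X] [Module ℂ X] [TopologicalSpace X]
  [IsTopologicalAddGroup X] [ContinuousSMul ℂ X]

/-- The point spectrum: all `z` such that `z I - T` is not injective. -/
def pointSpectrum (T : X →L[ℂ] X) : Set ℂ :=
  {z | ¬ Function.Injective (z • ContinuousLinearMap.id ℂ X - T)}

/-- Equicontinuity of a set of continuous linear operators. -/
def IsEquicontinuousSet (H : Set (X →L[ℂ] X)) : Prop :=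
  ∀ U ∈ 𝓝 (0 : X), ∃ V ∈ 𝓝 (0 : X), ∀ S ∈ H, ∀ x ∈ V, S x ∈ U

/-- The set `ρ*(T)`: all `z` such that some open disc around `z` is contained in the resolvent set
and the resolvents at the points of this disc form an equicontinuous set. -/
def resolventSetStar (T : X →L[ℂ] X) : Set ℂ :=
  {z | ∃ δ > 0, Metric.ball z δ ⊆ resolventSet ℂ T ∧
    IsEquicontinuousSet ((fun μ => resolvent T μ) '' Metric.ball z δ)}

/-- The set `σ*(T)`, the complement of `ρ*(T)`. -/
def spectrumStar (T : X →L[ℂ] X) : Set ℂ := (resolventSetStar T)ᶜ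

end Spectra

end CesaroSpec

end

/-! Nuclearity enters only through the growth condition `log n = O(αₙ)`
(`exists_log_le_of_nuclear`). It makes every weighted supremum seminorm on `E_α` have summable
weights. If `log n / αₙ` were unbounded, the running maximum `G` of this quotient would give a
weight `exp (-αₙ Gₙ / 2)` that decays fast enough to define a continuous seminorm but too slowly to
be summable.

Under the growth condition a factor `n ^ N` is absorbed by passing to a larger step
(`exists_step_of_growth`). Questions about `E_α` thus reduce to polynomial bounds for scalar
recursions. The binomial sequence `n ↦ C(n, m)` has polynomial growth, so it is an eigenvector in
`E_α` for `1 / (m + 1)`. For any other `z` the equation `z x - Cx = y` is triangular and uniquely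
solvable. With `u = Cx` it reads `(z (n + 1) - 1) uₙ = yₙ + z n uₙ₋₁`, and the factor `z n / (z (n +
1) - 1)` is `1 + O(1 / n)`, so its products grow polynomially. The bounds are uniform for `z` in a
bounded set at positive distance from `0` and all `1 / (n + 1)`, and they hold at the single point
`z = 0` too (`HasPolynomialResolvent`).

Uniform estimates from each step into another give equicontinuity (`exists_nhds_of_steps`), hence
the points of `ρ*`. The point `0` lies in the resolvent set but not in `ρ*`, because it is a limit
of eigenvalues. -/

namespace CesaroSpec

/-! ### Continuous seminorms on `E_α` -/

/-- A seminorm on `E_α` is continuous as soon as it is bounded on the unit ball of every step. -/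
theorem continuous_seminorm_of_steps {α s : ℕ → ℝ} (q : Seminorm ℂ (E α s))
    (hq : ∀ k, ∃ C : ℝ, ∀ x, q (incl α s k x) ≤ C * ‖x‖) : Continuous q := by
  -- Continuity of `q` is continuity of the identity into the seminormed space `(E_α, q)`, to which
  -- the universal property of the inductive limit applies.
  let T : E α s →ₗ[ℂ] WithSeminorm q :=
    { toFun := fun x => x, map_add' := fun _ _ => rfl, map_smul' := fun _ _ => rfl }
  have hT : Continuous T := by
    refine continuous_of_steps T fun k => ?_
    obtain ⟨C, hC⟩ := hq k
    exact AddMonoidHomClass.continuous_of_bound (T.comp (incl α s k)) C hC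
  exact continuous_norm.comp hT

/-- A continuous seminorm on `E_α` is bounded on the unit ball of every step. -/
theorem exists_bound_of_continuous_seminorm {α s : ℕ → ℝ} {q : Seminorm ℂ (E α s)}
    (hq : Continuous q) (k : ℕ) : ∃ C : ℝ, 0 ≤ C ∧ ∀ x, q (incl α s k x) ≤ C * ‖x‖ := by
  have h : Continuous (q.comp (incl α s k)) := hq.comp (continuous_incl α s k)
  obtain ⟨C, hC, hb⟩ := Seminorm.bound_of_continuous_normedSpace _ h
  exact ⟨C, hC.le, hb⟩

theorem C0.norm_le {w : ℕ → ℝ} {A : ℝ} (x : C0 w) (h : ∀ n, ‖(w n : ℂ) * x.1 n‖ ≤ A) : ‖x‖ ≤ A :=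
  ciSup_le h

theorem C0.le_norm {w : ℕ → ℝ} (x : C0 w) (n : ℕ) : ‖(w n : ℂ) * x.1 n‖ ≤ ‖x‖ :=
  le_ciSup x.bddAbove n

theorem weight_pos {α s : ℕ → ℝ} (hs : ∀ k, 1 < s k) (k n : ℕ) : 0 < weight α s k n :=
  Real.rpow_pos_of_pos (by linarith [hs k]) _

theorem inv_weight {α s : ℕ → ℝ} (hs : ∀ k, 1 < s k) (k n : ℕ) :
    (weight α s k n)⁻¹ = Real.exp (α n * Real.log (s k)) := by
  have h : 0 < s k := by linarith [hs k]
  rw [weight, Real.rpow_def_of_pos h, ← Real.exp_neg]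
  congr 1
  ring

theorem C0.coord_le {α s : ℕ → ℝ} (hs : ∀ k, 1 < s k) {k : ℕ} (x : C0 (weight α s k)) (n : ℕ) :
    ‖x.1 n‖ ≤ ‖x‖ * (weight α s k n)⁻¹ := by
  have h := x.le_norm n
  rw [norm_mul, Complex.norm_real, Real.norm_of_nonneg (weight_nonneg hs k n)] at h
  rw [← div_eq_mul_inv, le_div_iff₀' (weight_pos hs k n)]
  exact h

theorem exists_incl_eq {α s : ℕ → ℝ} (hα : ∀ n, 0 < α n) (hs : ∀ k, 1 < s k)
    (hsm : StrictMono s) (x : E α s) : ∃ k, ∃ y : C0 (weight α s k), incl α s k y = x := by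
  obtain ⟨k, hk⟩ := (mem_eSubmodule hα hs hsm x.1).1 x.2
  exact ⟨k, ⟨x.1, hk⟩, rfl⟩

/-- The coordinate functionals on `E_α`. -/
noncomputable def coord (α s : ℕ → ℝ) (n : ℕ) : E α s →ₗ[ℂ] ℂ :=
  (LinearMap.proj n).comp (eSubmodule α s).subtype

/-- The weighted supremum seminorm `x ↦ supₙ w(n) |x(n)|` is continuous on `E_α` if the weight `w`
times each growth rate of the steps is bounded. -/
theorem exists_weighted_seminorm {α s : ℕ → ℝ} (hα : ∀ n, 0 < α n) (hs : ∀ k, 1 < s k)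
    (hsm : StrictMono s) (w : ℕ → ℝ) (hw : ∀ n, 0 ≤ w n)
    (hb : ∀ k, ∃ C, ∀ n, w n * (weight α s k n)⁻¹ ≤ C) :
    ∃ p : Seminorm ℂ (E α s), Continuous p ∧ ∀ x n, w n * ‖x.1 n‖ ≤ p x := by
  let P : ℕ → Seminorm ℂ (E α s) := fun n =>
    (normSeminorm ℂ ℂ).comp ((w n : ℂ) • coord α s n)
  have hP : ∀ n x, P n x = w n * ‖x.1 n‖ := fun n x => by
    change ‖(w n : ℂ) * x.1 n‖ = _
    rw [norm_mul, Complex.norm_real, Real.norm_of_nonneg (hw n)]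
  have key : ∀ k, ∃ C : ℝ, ∀ (x : C0 (weight α s k)) n, P n (incl α s k x) ≤ C * ‖x‖ := by
    intro k
    obtain ⟨C, hC⟩ := hb k
    refine ⟨C, fun x n => ?_⟩
    rw [hP]
    calc w n * ‖x.1 n‖ ≤ w n * (‖x‖ * (weight α s k n)⁻¹) :=
          mul_le_mul_of_nonneg_left (x.coord_le hs n) (hw n)
      _ = (w n * (weight α s k n)⁻¹) * ‖x‖ := by ring
      _ ≤ C * ‖x‖ := mul_le_mul_of_nonneg_right (hC n) (norm_nonneg _)
  -- Pointwise boundedness is essential: the supremum of an unbounded family of seminorms is `0` by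
  -- default.
  have hbdd : ∀ x, BddAbove (Set.range fun n => P n x) := by
    intro x
    obtain ⟨k, y, rfl⟩ := exists_incl_eq hα hs hsm x
    obtain ⟨C, hC⟩ := key k
    exact ⟨C * ‖y‖, by rintro _ ⟨n, rfl⟩; exact hC y n⟩
  have hbdd' : BddAbove (Set.range P) := Seminorm.bddAbove_range_iff.2 hbdd
  refine ⟨⨆ n, P n, continuous_seminorm_of_steps _ fun k => ?_, fun x n => ?_⟩
  · obtain ⟨C, hC⟩ := key k
    refine ⟨C, fun x => ?_⟩
    rw [Seminorm.iSup_apply hbdd']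
    exact ciSup_le (hC x)
  · rw [Seminorm.iSup_apply hbdd', ← hP]
    exact le_ciSup (hbdd x) n

/-! ### Consequences of nuclearity -/

/-- Absolute summability forced by nuclearity: if the finite sums `∑ θᵢ eᵢ` with coefficients in the
closed unit disc form a bounded set, then the sums `∑ p(eᵢ)` are bounded. -/
theorem IsNuclearSpace.exists_sum_le {X : Type*} [AddCommGroup X] [Module ℂ X]
    [TopologicalSpace X] (hX : IsNuclearSpace X) (e : ℕ → X)
    (he : ∀ q : Seminorm ℂ X, Continuous q → ∃ C, ∀ (θ : ℕ → ℂ) (_ : ∀ n, ‖θ n‖ ≤ 1) (N : ℕ),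
      q (∑ i ∈ Finset.range N, θ i • e i) ≤ C)
    (p : Seminorm ℂ X) (hp : Continuous p) :
    ∃ S, ∀ N, ∑ i ∈ Finset.range N, p (e i) ≤ S := by
  obtain ⟨q, hq, -, T, hT, f, y, hsum, hrep⟩ := hX p hp
  obtain ⟨C, hC⟩ := he q hq
  have hnormq : ∀ x : X, ‖toLocal q x‖ = q x := fun x =>
    UniformSpace.Completion.norm_coe (E := WithSeminorm q) x
  have hnormp : ∀ x : X, ‖toLocal p x‖ = p x := fun x =>
    UniformSpace.Completion.norm_coe (E := WithSeminorm p) x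
  let L : X →ₗ[ℂ] LocalBanach q :=
    { toFun := toLocal q
      map_add' := fun a b => UniformSpace.Completion.coe_add (α := WithSeminorm q) a b
      map_smul' := fun c a => UniformSpace.Completion.coe_smul (X := WithSeminorm q) c a }
  -- the functionals `fⱼ` are summable along `e`
  have hf : ∀ j N, ∑ i ∈ Finset.range N, ‖f j (toLocal q (e i))‖ ≤ ‖f j‖ * C := by
    intro j N
    -- The phases `θᵢ` turn `∑ |fⱼ(eᵢ)|` into the value of `fⱼ` at one vector of the given bounded
    -- set.
    have hθ : ∀ i, ∃ θ : ℂ, ‖θ‖ ≤ 1 ∧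
        θ * f j (toLocal q (e i)) = (‖f j (toLocal q (e i))‖ : ℂ) := by
      intro i
      set z := f j (toLocal q (e i))
      by_cases hz : z = 0
      · exact ⟨0, by simp, by simp [hz]⟩
      · refine ⟨(‖z‖ : ℂ) / z, by simp [hz], by field_simp⟩
    choose θ hθ1 hθ2 using hθ
    have h1 : f j (L (∑ i ∈ Finset.range N, θ i • e i)) =
        ((∑ i ∈ Finset.range N, ‖f j (toLocal q (e i))‖ : ℝ) : ℂ) := by
      rw [map_sum, map_sum]
      push_cast
      refine Finset.sum_congr rfl fun i _ => ?_
      rw [map_smul, map_smul, smul_eq_mul]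
      exact hθ2 i
    have h2 := (f j).le_opNorm (L (∑ i ∈ Finset.range N, θ i • e i))
    rw [h1, Complex.norm_real, Real.norm_of_nonneg
      (Finset.sum_nonneg fun _ _ => norm_nonneg _)] at h2
    refine h2.trans (mul_le_mul_of_nonneg_left ?_ (norm_nonneg _))
    exact (hnormq _).le.trans (hC θ hθ1 N)
  have hs1 : ∀ x : X, Summable fun j => ‖f j (toLocal q x)‖ * ‖y j‖ := by
    intro x
    refine Summable.of_nonneg_of_le (fun j => by positivity) (fun j => ?_)
      (hsum.mul_right (q x))
    calc ‖f j (toLocal q x)‖ * ‖y j‖ ≤ (‖f j‖ * ‖toLocal q x‖) * ‖y j‖ :=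
          mul_le_mul_of_nonneg_right ((f j).le_opNorm _) (norm_nonneg _)
      _ = ‖f j‖ * ‖y j‖ * q x := by rw [hnormq]; ring
  have hpe : ∀ x : X, p x ≤ ∑' j, ‖f j (toLocal q x)‖ * ‖y j‖ := by
    intro x
    rw [← hnormp, ← hT, ← (hrep (toLocal q x)).tsum_eq]
    refine (norm_tsum_le_tsum_norm ?_).trans_eq ?_
    · simpa only [norm_smul] using hs1 x
    · simp only [norm_smul]
  refine ⟨∑' j, ‖f j‖ * ‖y j‖ * C, fun N => ?_⟩
  calc ∑ i ∈ Finset.range N, p (e i)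
      ≤ ∑ i ∈ Finset.range N, ∑' j, ‖f j (toLocal q (e i))‖ * ‖y j‖ :=
        Finset.sum_le_sum fun i _ => hpe (e i)
    _ = ∑' j, ∑ i ∈ Finset.range N, ‖f j (toLocal q (e i))‖ * ‖y j‖ :=
        (Summable.tsum_finsetSum fun i _ => hs1 (e i)).symm
    _ ≤ ∑' j, ‖f j‖ * ‖y j‖ * C := by
        refine Summable.tsum_le_tsum (fun j => ?_) (summable_sum fun i _ => hs1 (e i))
          (hsum.mul_right C)
        rw [← Finset.sum_mul, mul_right_comm]
        exact mul_le_mul_of_nonneg_right (hf j N) (norm_nonneg _)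

theorem weight_le_one {α s : ℕ → ℝ} (hα : ∀ n, 0 < α n) (hs : ∀ k, 1 < s k) (k n : ℕ) :
    weight α s k n ≤ 1 :=
  Real.rpow_le_one_of_one_le_of_nonpos (hs k).le (by linarith [hα n])

theorem single_mem_c0Submodule (w : ℕ → ℝ) (n : ℕ) : Pi.single n 1 ∈ c0Submodule w := by
  refine tendsto_const_nhds.congr' ?_
  filter_upwards [eventually_gt_atTop n] with m hm
  simp [Pi.single_eq_of_ne hm.ne']

/-- The unit vectors in the steps. -/
def C0.unit (w : ℕ → ℝ) (n : ℕ) : C0 w := ⟨Pi.single n 1, single_mem_c0Submodule w n⟩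

theorem C0.sum_unit_apply (w : ℕ → ℝ) (θ : ℕ → ℂ) (N n : ℕ) :
    (∑ i ∈ Finset.range N, θ i • C0.unit w i).1 n = if n < N then θ n else 0 := by
  let ev : C0 w →ₗ[ℂ] ℂ := (LinearMap.proj n).comp (c0Submodule w).subtype
  change ev _ = _
  have h : ∀ i, ev (C0.unit w i) = if n = i then 1 else 0 := fun i => Pi.single_apply i 1 n
  simp [map_sum, h]

/-- In a nuclear space `E_α`, the weights of weighted supremum seminorms are summable. -/
theorem exists_sum_weight_le {α s : ℕ → ℝ} (hα : ∀ n, 0 < α n) (hs : ∀ k, 1 < s k)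
    (hsm : StrictMono s) (hnuc : IsNuclearSpace (E α s)) (w : ℕ → ℝ) (hw : ∀ n, 0 ≤ w n)
    (hb : ∀ k, ∃ C, ∀ n, w n * (weight α s k n)⁻¹ ≤ C) :
    ∃ S, ∀ N, ∑ i ∈ Finset.range N, w i ≤ S := by
  obtain ⟨p, hp, hwp⟩ := exists_weighted_seminorm hα hs hsm w hw hb
  -- All weights are at most `1`, so the sums `∑ θᵢ eᵢ` of unit vectors lie in the unit ball of the
  -- step `k = 0`.
  obtain ⟨S, hS⟩ := hnuc.exists_sum_le (fun n => incl α s 0 (C0.unit _ n)) (fun q hq => by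
    obtain ⟨C, hC0, hC⟩ := exists_bound_of_continuous_seminorm hq 0
    refine ⟨C, fun θ hθ N => ?_⟩
    have h : ∑ i ∈ Finset.range N, θ i • incl α s 0 (C0.unit _ i) =
        incl α s 0 (∑ i ∈ Finset.range N, θ i • C0.unit _ i) := by
      simp only [map_sum, map_smul]
    rw [h]
    refine (hC _).trans (mul_le_of_le_one_right hC0 (C0.norm_le _ fun n => ?_))
    rw [C0.sum_unit_apply, norm_mul, Complex.norm_real,
      Real.norm_of_nonneg (weight_nonneg hs 0 n)]
    refine mul_le_one₀ (weight_le_one hα hs 0 n) (norm_nonneg _) ?_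
    split_ifs
    · exact hθ n
    · simp) p hp
  refine ⟨S, fun N => (Finset.sum_le_sum fun i _ => ?_).trans (hS N)⟩
  have h := hwp (incl α s 0 (C0.unit _ i)) i
  have h1 : (incl α s 0 (C0.unit _ i)).1 i = 1 := Pi.single_eq_same i 1
  rwa [h1, norm_one, mul_one] at h

/-- If `E_α` is nuclear, then `log n = O(αₙ)`. -/
theorem exists_log_le_of_nuclear {α s : ℕ → ℝ} (hα : ∀ n, 0 < α n) (hαm : StrictMono α)
    (hs : ∀ k, 1 < s k) (hsm : StrictMono s) (hnuc : IsNuclearSpace (E α s)) :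
    ∃ M, ∀ n : ℕ, Real.log (n + 1) ≤ M * α n := by
  let h : ℕ → ℝ := fun n => Real.log (n + 1) / α n
  let G : ℕ → ℝ := partialSups h
  have hG : Monotone G := (partialSups h).monotone
  have hhG : ∀ n, h n ≤ G n := fun n => le_partialSups h n
  have hGh : ∀ n, ∃ m ≤ n, G n = h m := fun n => by
    obtain ⟨m, hm, h1⟩ := exists_partialSups_eq h n
    exact ⟨m, hm, h1⟩
  by_cases hbd : ∃ M, ∀ n, G n ≤ M
  · obtain ⟨M, hM⟩ := hbd
    refine ⟨M, fun n => ?_⟩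
    rw [← div_le_iff₀ (hα n)]
    exact (hhG n).trans (hM n)
  exfalso
  have hGtop : Tendsto G atTop atTop :=
    tendsto_atTop_atTop_of_monotone hG fun b => by
      by_contra! hb
      exact hbd ⟨b, fun n => (hb n).le⟩
  -- Since `G → ∞`, this weight eventually beats each rate `exp (αₙ log s_k)`. The factor `1 / 2`
  -- makes its value at a record index `m` equal to `(m + 1) ^ (-1/2)`.
  obtain ⟨S, hS⟩ := exists_sum_weight_le hα hs hsm hnuc
    (fun n => Real.exp (-(α n * G n / 2))) (fun n => (Real.exp_pos _).le) (fun k => by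
      have hev : ∀ᶠ n in atTop,
          Real.exp (-(α n * G n / 2)) * (weight α s k n)⁻¹ ≤ 1 := by
        filter_upwards [hGtop.eventually_ge_atTop (2 * Real.log (s k))] with n hn
        rw [inv_weight hs, ← Real.exp_add, Real.exp_le_one_iff]
        nlinarith [hα n]
      have hbdd := Filter.IsBoundedUnder.bddAbove_range
        (f := fun n => Real.exp (-(α n * G n / 2)) * (weight α s k n)⁻¹) ⟨1, hev⟩
      obtain ⟨C, hC⟩ := hbdd
      exact ⟨C, fun n => hC ⟨n, rfl⟩⟩)
  obtain ⟨m₀, hm₀⟩ := exists_nat_ge (S ^ 2)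
  refine hbd ⟨G m₀, fun n => ?_⟩
  obtain ⟨m, hmn, hm⟩ := hGh n
  rw [hm]
  refine (hhG m).trans (hG ?_)
  -- The maximum is attained at the record index `m`. As `αᵢ Gᵢ` is monotone, the first `m + 1`
  -- weights are at least `(m + 1) ^ (-1/2)`, so `√(m + 1) ≤ S`. Hence every record index lies below
  -- `m₀`, and `G` is bounded by `G m₀`.
  have hGm : G m = h m := le_antisymm ((hG hmn).trans hm.le) (hhG m)
  have hlog : α m * G m = Real.log (m + 1) := by
    rw [hGm]; exact mul_div_cancel₀ _ (hα m).ne'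
  have hterm : ∀ i ∈ Finset.range (m + 1),
      Real.exp (-(Real.log (m + 1) / 2)) ≤ Real.exp (-(α i * G i / 2)) := by
    intro i hi
    have him : i ≤ m := Nat.lt_succ_iff.1 (Finset.mem_range.1 hi)
    rw [Real.exp_le_exp, ← hlog]
    have h0 : 0 ≤ G i := (div_nonneg (Real.log_nonneg (by simp)) (hα i).le).trans (hhG i)
    have := mul_le_mul (hαm.monotone him) (hG him) h0 (hα m).le
    linarith
  have h1 := (Finset.card_nsmul_le_sum _ _ _ hterm).trans (hS (m + 1))
  have hpos : (0 : ℝ) < m + 1 := by positivity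
  set r := Real.exp (Real.log (m + 1) / 2) with hr
  have hr2 : r * r = m + 1 := by
    rw [hr, ← Real.exp_add, add_halves, Real.exp_log hpos]
  have hrpos : 0 < r := Real.exp_pos _
  rw [Real.exp_neg, ← hr, Finset.card_range, nsmul_eq_mul] at h1
  push_cast at h1
  rw [← hr2, mul_assoc, mul_inv_cancel₀ hrpos.ne', mul_one] at h1
  have h2 : (m : ℝ) + 1 ≤ m₀ := by nlinarith
  have h3 : m + 1 ≤ m₀ := by exact_mod_cast h2
  omega

/-! ### Equicontinuity on `E_α` -/

open scoped ComplexOrder in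
/-- The neighbourhoods of `0` of a complex locally convex space contain unit balls of continuous
seminorms. -/
theorem exists_seminorm_ball_subset {X : Type*} [AddCommGroup X] [Module ℂ X] [TopologicalSpace X]
    [IsTopologicalAddGroup X] [ContinuousSMul ℂ X] [LocallyConvexSpace ℝ X] {U : Set X}
    (hU : U ∈ 𝓝 (0 : X)) : ∃ p : Seminorm ℂ X, Continuous p ∧ p.ball 0 1 ⊆ U := by
  have : ContinuousSMul ℝ X := IsScalarTower.continuousSMul ℂ
  have : LocallyConvexSpace ℂ X := by
    refine ⟨fun x => ?_⟩
    simpa only [convex_RCLike_iff_convex_real] using LocallyConvexSpace.convex_basis (𝕜 := ℝ) x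
  obtain ⟨S, hS, hSU⟩ := (nhds_hasBasis_absConvex_open ℂ X).mem_iff.1 hU
  let S' : AbsConvexOpenSets ℂ X := ⟨S, hS⟩
  refine ⟨gaugeSeminormFamily ℂ X S', with_gaugeSeminormFamily.continuous_seminorm S', ?_⟩
  rw [gaugeSeminormFamily_ball]
  exact hSU

/-- A family of linear maps which is uniformly bounded from each step into some step is
equicontinuous. -/
theorem exists_nhds_of_steps {α s : ℕ → ℝ} (hα : ∀ n, 0 < α n) (hs : ∀ k, 1 < s k)
    (hsm : StrictMono s) {ι : Type*} (S : ι → E α s →ₗ[ℂ] E α s)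
    (hS : ∀ k, ∃ l, ∃ K : ℝ, ∀ i (x : C0 (weight α s k)), ∃ y : C0 (weight α s l),
      incl α s l y = S i (incl α s k x) ∧ ‖y‖ ≤ K * ‖x‖) {U : Set (E α s)} (hU : U ∈ 𝓝 0) :
    ∃ V ∈ 𝓝 (0 : E α s), ∀ i, ∀ x ∈ V, S i x ∈ U := by
  obtain ⟨p, hp, hpU⟩ := exists_seminorm_ball_subset hU
  let P : ι → Seminorm ℂ (E α s) := fun i => p.comp (S i)
  have key : ∀ k, ∃ C : ℝ, 0 ≤ C ∧ ∀ (x : C0 (weight α s k)) i, P i (incl α s k x) ≤ C * ‖x‖ := by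
    intro k
    obtain ⟨l, K, hK⟩ := hS k
    obtain ⟨C, hC0, hC⟩ := exists_bound_of_continuous_seminorm hp l
    refine ⟨C * max K 0, mul_nonneg hC0 (le_max_right _ _), fun x i => ?_⟩
    obtain ⟨y, hy, hyK⟩ := hK i x
    change p (S i (incl α s k x)) ≤ _
    rw [← hy, mul_assoc]
    refine (hC y).trans (mul_le_mul_of_nonneg_left (hyK.trans ?_) hC0)
    exact mul_le_mul_of_nonneg_right (le_max_left _ _) (norm_nonneg _)
  have hbdd : ∀ x, BddAbove (Set.range fun i => P i x) := by
    intro x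
    obtain ⟨k, y, rfl⟩ := exists_incl_eq hα hs hsm x
    obtain ⟨C, -, hC⟩ := key k
    exact ⟨C * ‖y‖, by rintro _ ⟨n, rfl⟩; exact hC y n⟩
  have hbdd' : BddAbove (Set.range P) := Seminorm.bddAbove_range_iff.2 hbdd
  have hq : Continuous (⨆ i, P i : Seminorm ℂ (E α s)) :=
    continuous_seminorm_of_steps _ fun k => by
      obtain ⟨C, hC0, hC⟩ := key k
      refine ⟨C, fun x => ?_⟩
      rw [Seminorm.iSup_apply hbdd']
      -- The index type may be empty, in which case the supremum is `0`; this is why the bound must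
      -- be nonnegative.
      exact Real.iSup_le (hC x) (mul_nonneg hC0 (norm_nonneg _))
  refine ⟨(⨆ i, P i).ball 0 1, Seminorm.ball_mem_nhds hq one_pos, fun i x hx => hpU ?_⟩
  rw [Seminorm.mem_ball_zero] at hx ⊢
  rw [Seminorm.iSup_apply hbdd'] at hx
  exact (le_ciSup (hbdd x) i).trans_lt hx

/-! ### Polynomial growth -/

/-- If `log n = O(αₙ)`, then multiplying the growth rate of a step by a power of `n` leads into a
larger step. -/
theorem exists_step_of_growth {α s : ℕ → ℝ} (hα_top : Tendsto α atTop atTop)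
    (hα : ∀ n, 0 < α n)
    (hs : ∀ k, 1 < s k) (hs_top : Tendsto s atTop atTop) {M : ℝ}
    (hM : ∀ n : ℕ, Real.log (n + 1) ≤ M * α n) (k N : ℕ) :
    ∃ l, ∀ (A : ℝ) (x : ℕ → ℂ), 0 ≤ A →
      (∀ n : ℕ, ‖x n‖ ≤ A * ((n + 1 : ℝ) ^ N * (weight α s k n)⁻¹)) →
      x ∈ c0Submodule (weight α s l) ∧ ∀ n, ‖((weight α s l n : ℝ) : ℂ) * x n‖ ≤ A := by
  have hlog : Tendsto (fun l => Real.log (s l)) atTop atTop := Real.tendsto_log_atTop.comp hs_top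
  -- The term `M * N` absorbs `(n + 1) ^ N`, `log (s k)` absorbs the old weight, and the extra `1`
  -- leaves a factor `exp (-αₙ)`, which yields a null sequence and not merely a bounded one.
  obtain ⟨l, hl⟩ := (hlog.eventually_ge_atTop (M * N + Real.log (s k) + 1)).exists
  refine ⟨l, fun A x hA hx => ?_⟩
  have hexp : ∀ n : ℕ, weight α s l n * ((n + 1 : ℝ) ^ N * (weight α s k n)⁻¹)
      ≤ Real.exp (-α n) := by
    intro n
    have h1 : weight α s l n = Real.exp (-(α n * Real.log (s l))) := by
      rw [Real.exp_neg, ← inv_weight hs, inv_inv]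
    have h2 : (n + 1 : ℝ) ^ N = Real.exp (N * Real.log (n + 1)) := by
      rw [mul_comm, Real.exp_mul, Real.exp_log (by positivity), Real.rpow_natCast]
    rw [h1, h2, inv_weight hs, ← Real.exp_add, ← Real.exp_add, Real.exp_le_exp]
    have h3 : (N : ℝ) * Real.log (n + 1) ≤ N * (M * α n) :=
      mul_le_mul_of_nonneg_left (hM n) (Nat.cast_nonneg _)
    have h4 := mul_le_mul_of_nonneg_left hl (hα n).le
    nlinarith
  have hb : ∀ n, ‖((weight α s l n : ℝ) : ℂ) * x n‖ ≤ A * Real.exp (-α n) := by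
    intro n
    rw [norm_mul, Complex.norm_real, Real.norm_of_nonneg (weight_nonneg hs l n)]
    calc weight α s l n * ‖x n‖
        ≤ weight α s l n * (A * ((n + 1 : ℝ) ^ N * (weight α s k n)⁻¹)) :=
          mul_le_mul_of_nonneg_left (hx n) (weight_nonneg hs l n)
      _ = A * (weight α s l n * ((n + 1 : ℝ) ^ N * (weight α s k n)⁻¹)) := by ring
      _ ≤ A * Real.exp (-α n) := mul_le_mul_of_nonneg_left (hexp n) hA
  refine ⟨squeeze_zero_norm hb ?_, fun n => (hb n).trans ?_⟩
  · have h := (Real.tendsto_exp_neg_atTop_nhds_zero.comp hα_top).const_mul A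
    simpa using h
  · exact mul_le_of_le_one_right hA (Real.exp_le_one_iff.2 (by linarith [hα n]))

/-! ### The resolvent equation on sequences -/

theorem cesaroSeq_apply (x : ℕ → ℂ) (n : ℕ) :
    cesaroSeq x n = (∑ i ∈ Finset.range (n + 1), x i) / ((n : ℂ) + 1) := rfl

theorem succ_mul_cesaroSeq (x : ℕ → ℂ) (n : ℕ) :
    ((n : ℂ) + 1) * cesaroSeq x n = ∑ i ∈ Finset.range (n + 1), x i := by
  rw [cesaroSeq_apply, mul_div_cancel₀ _ (Nat.cast_add_one_ne_zero n)]

/-- The system is lower triangular with diagonal entries `z - 1 / (n + 1)`, so forward substitution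
works. Here `S n` is the sum of the entries before `n`, and `F n (S n)` is the entry they force. -/
theorem exists_resolvent_solution {z : ℂ} (hz : ∀ n : ℕ, z ≠ 1 / ((n : ℂ) + 1)) (y : ℕ → ℂ) :
    ∃ x : ℕ → ℂ, ∀ n, z * x n - cesaroSeq x n = y n := by
  let F : ℕ → ℂ → ℂ := fun n S => (y n + S / ((n : ℂ) + 1)) / (z - 1 / ((n : ℂ) + 1))
  let S : ℕ → ℂ := fun n => Nat.rec 0 (fun m S => S + F m S) n
  have hS : ∀ n, ∑ i ∈ Finset.range n, F i (S i) = S n := by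
    intro n
    induction n with
    | zero => rfl
    | succ n ih => rw [Finset.sum_range_succ, ih]
  refine ⟨fun n => F n (S n), fun n => ?_⟩
  rw [cesaroSeq_apply, Finset.sum_range_succ, hS]
  have h1 : z - 1 / ((n : ℂ) + 1) ≠ 0 := sub_ne_zero.2 (hz n)
  have h2 : (z - 1 / ((n : ℂ) + 1)) * F n (S n) = y n + S n / ((n : ℂ) + 1) :=
    mul_div_cancel₀ _ h1
  linear_combination h2

/-- The resolvents of the Cesàro operator at the points of `Λ` are uniformly of polynomial
growth. -/
def HasPolynomialResolvent (Λ : Set ℂ) : Prop :=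
  ∃ (K : ℝ) (N : ℕ), 0 ≤ K ∧ ∀ z ∈ Λ, ∀ (x y : ℕ → ℂ) (B : ℕ → ℝ), Monotone B →
    (∀ n, ‖y n‖ ≤ B n) → (∀ n, z * x n - cesaroSeq x n = y n) →
    ∀ n : ℕ, ‖x n‖ ≤ K * ((n + 1 : ℝ) ^ N * B n)

/-- For `z = 0` the averages of `x` are `-y`, and differencing the partial sums gives `xₙ = n yₙ₋₁ -
(n + 1) yₙ`. Monotonicity of `B` controls `yₙ₋₁` by `B n`. -/
theorem hasPolynomialResolvent_zero : HasPolynomialResolvent {0} := by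
  refine ⟨2, 1, by norm_num, ?_⟩
  rintro z rfl x y B hB hy h n
  have hu : ∀ n, cesaroSeq x n = -y n := fun n => by rw [← h n]; ring
  have hn := succ_mul_cesaroSeq x n
  have hnorm : ‖((n : ℂ) + 1) * y n‖ ≤ (n + 1 : ℝ) * B n := by
    rw [norm_mul]
    have : ‖(n : ℂ) + 1‖ = (n + 1 : ℝ) := by exact_mod_cast Complex.norm_natCast (n + 1)
    rw [this]
    exact mul_le_mul_of_nonneg_left (hy n) (by positivity)
  have hBn : 0 ≤ B n := (norm_nonneg _).trans (hy n)
  rw [pow_one]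
  cases n with
  | zero =>
    have hx : x 0 = -(((0 : ℕ) : ℂ) + 1) * y 0 := by
      simp [hu] at hn
      simp [hn]
    rw [hx, neg_mul, norm_neg]
    push_cast at *
    linarith
  | succ m =>
    have hm := succ_mul_cesaroSeq x m
    rw [Finset.sum_range_succ, ← hm, hu, hu] at hn
    have hx : x (m + 1) = ((m : ℂ) + 1) * y m - (((m + 1 : ℕ) : ℂ) + 1) * y (m + 1) := by
      linear_combination -hn
    have h2 : ‖((m : ℂ) + 1) * y m‖ ≤ (m + 1 : ℝ) * B (m + 1) := by
      rw [norm_mul]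
      have : ‖(m : ℂ) + 1‖ = (m + 1 : ℝ) := by exact_mod_cast Complex.norm_natCast (m + 1)
      rw [this]
      exact mul_le_mul_of_nonneg_left ((hy m).trans (hB m.le_succ)) (by positivity)
    rw [hx]
    refine (norm_sub_le _ _).trans ?_
    push_cast at *
    nlinarith

/-- This is the induction step showing that `(n + 1) ^ (c + 1)` majorizes the recursion `aₙ = 1 / (n
+ 1) + (1 + c / (n + 1)) aₙ₋₁`. By Bernoulli, `(n + 1) ^ (c + 1)` exceeds `n ^ (c + 1)` by at least
`(c + 1) n ^ c`. Of this, `c n ^ c` covers the multiplicative growth, and the spare `n ^ c` covers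
`1 / (n + 1)`. -/
theorem succ_pow_ge (n c : ℕ) :
    (1 : ℝ) / (n + 1) + (1 + c / (n + 1)) * (n : ℝ) ^ (c + 1) ≤ (n + 1 : ℝ) ^ (c + 1) := by
  rcases Nat.eq_zero_or_pos n with rfl | hn
  · simp
  have hn1 : (1 : ℝ) ≤ n := by exact_mod_cast hn
  have hpow : (1 : ℝ) ≤ (n : ℝ) ^ c := one_le_pow₀ hn1
  have hbern : (n : ℝ) ^ (c + 1) + (c + 1) * (n : ℝ) ^ c ≤ (n + 1 : ℝ) ^ (c + 1) := by
    have h := one_add_mul_le_pow (a := (1 : ℝ) / n) (by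
      have : (0 : ℝ) ≤ 1 / n := by positivity
      linarith) (c + 1)
    have h2 := mul_le_mul_of_nonneg_left h (pow_nonneg (zero_le_one.trans hn1) (c + 1))
    have h3 : (n : ℝ) * (1 + 1 / n) = n + 1 := by field_simp
    rw [← mul_pow, h3] at h2
    refine le_trans (le_of_eq ?_) h2
    push_cast
    field_simp
    ring
  refine le_trans ?_ hbern
  have h3 : (1 : ℝ) / (n + 1) + c / (n + 1) * (n : ℝ) ^ (c + 1) ≤ (c + 1) * (n : ℝ) ^ c := by
    rw [div_mul_eq_mul_div, ← add_div, div_le_iff₀ (by positivity), pow_succ]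
    have hc : (0 : ℝ) ≤ c := Nat.cast_nonneg c
    nlinarith [mul_nonneg hc (zero_le_one.trans hpow)]
  linarith

/-- Uniform polynomial growth of the resolvents away from `0` and the numbers `1 / (n + 1)`. -/
theorem hasPolynomialResolvent_of_dist {Λ : Set ℂ} {d R : ℝ} (hd : 0 < d)
    (h0 : ∀ z ∈ Λ, d ≤ ‖z‖) (h1 : ∀ z ∈ Λ, ∀ n : ℕ, d ≤ ‖z - 1 / ((n : ℂ) + 1)‖)
    (hR : ∀ z ∈ Λ, ‖1 - z‖ ≤ R) : HasPolynomialResolvent Λ := by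
  -- This `c` bounds `(n + 1) |1 - z| / |z (n + 1) - 1|`. In the constant below, `1 + 1 / d` bounds
  -- `y + u`, and the last division by `d` comes from `x = (y + u) / z`.
  obtain ⟨c, hc⟩ := exists_nat_ge (R / d)
  refine ⟨(1 + 1 / d) / d, c + 1, by positivity, fun z hz x y B hB hy h => ?_⟩
  have hz0 : z ≠ 0 := norm_pos_iff.1 (hd.trans_le (h0 z hz))
  have hB0 : ∀ n, 0 ≤ B n := fun n => (norm_nonneg _).trans (hy n)
  set u := cesaroSeq x with hu
  have hden : ∀ n : ℕ, d * (n + 1) ≤ ‖z * ((n : ℂ) + 1) - 1‖ := by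
    intro n
    have hn : (n : ℂ) + 1 ≠ 0 := Nat.cast_add_one_ne_zero n
    have : z * ((n : ℂ) + 1) - 1 = (z - 1 / ((n : ℂ) + 1)) * ((n : ℂ) + 1) := by field_simp
    have h2 : ‖(n : ℂ) + 1‖ = (n + 1 : ℝ) := by exact_mod_cast Complex.norm_natCast (n + 1)
    rw [this, norm_mul, h2]
    exact mul_le_mul_of_nonneg_right (h1 z hz n) (by positivity)
  -- one step of the recursion for `u`
  have step : ∀ (n : ℕ) (v : ℂ), (z * ((n : ℂ) + 1) - 1) * u n = y n + z * n * v →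
      ‖u n‖ ≤ B n / (d * (n + 1)) + (1 + c / (n + 1)) * ‖v‖ := by
    intro n v hv
    have hpos : 0 < d * ((n : ℝ) + 1) := by positivity
    have hD := hpos.trans_le (hden n)
    have hD0 : z * ((n : ℂ) + 1) - 1 ≠ 0 := norm_pos_iff.1 hD
    -- The multiplier is rewritten through `z n = (z (n + 1) - 1) + (1 - z)`.
    have huv : u n = y n / (z * ((n : ℂ) + 1) - 1) +
        (1 + (1 - z) / (z * ((n : ℂ) + 1) - 1)) * v := by
      field_simp
      linear_combination hv
    rw [huv]
    refine (norm_add_le _ _).trans (add_le_add ?_ ?_)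
    · rw [norm_div]
      exact div_le_div₀ (hB0 n) (hy n) hpos (hden n)
    · rw [norm_mul]
      refine mul_le_mul_of_nonneg_right ((norm_add_le _ _).trans ?_) (norm_nonneg _)
      rw [norm_one, norm_div]
      refine add_le_add le_rfl ?_
      calc ‖1 - z‖ / ‖z * ((n : ℂ) + 1) - 1‖ ≤ R / (d * (n + 1)) :=
            div_le_div₀ ((norm_nonneg _).trans (hR z hz)) (hR z hz) hpos (hden n)
        _ = R / d / (n + 1) := by rw [div_div]
        _ ≤ c / (n + 1) := div_le_div_of_nonneg_right hc (by positivity)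
  have hubound : ∀ n : ℕ, ‖u n‖ ≤ 1 / d * ((n + 1 : ℝ) ^ (c + 1) * B n) := by
    intro n
    induction n with
    | zero =>
      have hx0 : x 0 = u 0 := by simp [hu, cesaroSeq_apply]
      have h2 := step 0 0 (by rw [← h 0, hx0]; push_cast; ring)
      simp at h2 ⊢
      rw [inv_mul_eq_div]
      exact h2
    | succ n ih =>
      have h2 := step (n + 1) (u n) (by
        have ha := succ_mul_cesaroSeq x (n + 1)
        have hb := succ_mul_cesaroSeq x n
        rw [Finset.sum_range_succ, ← hb, ← hu] at ha
        push_cast at ha ⊢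
        rw [← h (n + 1)]
        linear_combination z * ha)
      refine h2.trans ?_
      have h3 := succ_pow_ge (n + 1) c
      have h4 : ‖u n‖ ≤ 1 / d * (((n + 1 : ℕ) : ℝ) ^ (c + 1) * B (n + 1)) := by
        refine ih.trans ?_
        push_cast
        have := hB n.le_succ
        gcongr
      have h5 := mul_le_mul_of_nonneg_left h3
        (mul_nonneg (one_div_pos.2 hd).le (hB0 (n + 1)))
      have h6 := mul_le_mul_of_nonneg_left h4
        (show (0 : ℝ) ≤ 1 + c / (((n + 1 : ℕ) : ℝ) + 1) by positivity)
      have h7 : B (n + 1) / (d * (((n + 1 : ℕ) : ℝ) + 1)) =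
          1 / d * B (n + 1) * (1 / (((n + 1 : ℕ) : ℝ) + 1)) := by
        field_simp
      rw [h7]
      linarith
  intro n
  have hx : x n = (y n + u n) / z := by
    rw [eq_div_iff hz0, ← h n]; ring
  have hp1 : (1 : ℝ) ≤ (n + 1 : ℝ) ^ (c + 1) := one_le_pow₀ (by simp)
  have hsum : ‖y n + u n‖ ≤ (1 + 1 / d) * ((n + 1 : ℝ) ^ (c + 1) * B n) := by
    refine (norm_add_le _ _).trans ?_
    have := (hy n).trans (le_mul_of_one_le_left (hB0 n) hp1)
    have := hubound n
    linarith
  rw [hx, norm_div, div_mul_eq_mul_div]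
  exact div_le_div₀ ((norm_nonneg _).trans hsum) hsum hd (h0 z hz)

/-! ### The spectrum of the Cesàro operator -/

/-- The distances to `1 / (n + 1)` converge to `‖z‖ > 0`, so all but finitely many exceed `‖z‖ / 2`;
the rest have a positive minimum. -/
theorem exists_pos_dist {z : ℂ} (hz0 : z ≠ 0) (hz : ∀ n : ℕ, z ≠ 1 / ((n : ℂ) + 1)) :
    ∃ d > 0, d ≤ ‖z‖ ∧ ∀ n : ℕ, d ≤ ‖z - 1 / ((n : ℂ) + 1)‖ := by
  have hlim : Tendsto (fun n : ℕ => ‖z - 1 / ((n : ℂ) + 1)‖) atTop (𝓝 ‖z‖) := by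
    have h := (tendsto_one_div_add_atTop_nhds_zero_nat (𝕜 := ℂ)).const_sub z
    simpa using h.norm
  have hpos : 0 < ‖z‖ := norm_pos_iff.2 hz0
  obtain ⟨m, hm⟩ := eventually_atTop.1 (hlim.eventually (eventually_ge_nhds (half_lt_self hpos)))
  have hfin : ∃ d > 0, ∀ n ∈ Finset.range m, d ≤ ‖z - 1 / ((n : ℂ) + 1)‖ := by
    rcases (Finset.range m).eq_empty_or_nonempty with h | h
    · exact ⟨1, one_pos, by simp [h]⟩
    · obtain ⟨i, -, hi⟩ := Finset.exists_min_image _ (fun n : ℕ => ‖z - 1 / ((n : ℂ) + 1)‖) h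
      exact ⟨_, norm_pos_iff.2 (sub_ne_zero.2 (hz i)), hi⟩
  obtain ⟨d, hd, hdm⟩ := hfin
  refine ⟨min d (‖z‖ / 2), lt_min hd (half_pos hpos), (min_le_right _ _).trans (by linarith),
    fun n => ?_⟩
  rcases lt_or_ge n m with h | h
  · exact (min_le_left _ _).trans (hdm n (Finset.mem_range.2 h))
  · exact (min_le_right _ _).trans (hm n h)

/-- Around each point off `{0} ∪ {1 / (n + 1)}` the resolvents are of uniform polynomial growth. -/
theorem exists_ball_hasPolynomialResolvent {z : ℂ} (hz0 : z ≠ 0)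
    (hz : ∀ n : ℕ, z ≠ 1 / ((n : ℂ) + 1)) :
    ∃ δ > 0, HasPolynomialResolvent (Metric.ball z δ) ∧
      ∀ μ ∈ Metric.ball z δ, ∀ n : ℕ, μ ≠ 1 / ((n : ℂ) + 1) := by
  obtain ⟨d, hd, hd0, hd1⟩ := exists_pos_dist hz0 hz
  have key : ∀ μ ∈ Metric.ball z (d / 2), ∀ a : ℂ, d ≤ ‖z - a‖ → d / 2 ≤ ‖μ - a‖ := by
    intro μ hμ a ha
    rw [Metric.mem_ball, dist_comm, dist_eq_norm] at hμ
    have := norm_sub_le_norm_sub_add_norm_sub z μ a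
    linarith
  have h1 : ∀ μ ∈ Metric.ball z (d / 2), ∀ n : ℕ, d / 2 ≤ ‖μ - 1 / ((n : ℂ) + 1)‖ :=
    fun μ hμ n => key μ hμ _ (hd1 n)
  refine ⟨d / 2, half_pos hd, hasPolynomialResolvent_of_dist (R := ‖1 - z‖ + d / 2) (half_pos hd)
    (fun μ hμ => ?_) h1 (fun μ hμ => ?_), fun μ hμ n h => ?_⟩
  · simpa using key μ hμ 0 (by simpa using hd0)
  · rw [Metric.mem_ball, dist_comm, dist_eq_norm] at hμ
    have := norm_sub_le_norm_sub_add_norm_sub 1 z μ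
    linarith
  · have := h1 μ hμ n
    rw [h, sub_self, norm_zero] at this
    linarith

section Resolvent

variable {α s : ℕ → ℝ} {M : ℝ}

/-- Solution operators of the resolvent equations at the points of a set on which the resolvents are
of polynomial growth are equicontinuous. -/
theorem exists_nhds_of_solutions (hα0 : ∀ n, 0 < α n) (hα : StrictMono α)
    (hα_top : Tendsto α atTop atTop) (hs1 : ∀ k, 1 < s k) (hs : StrictMono s)
    (hs_top : Tendsto s atTop atTop) (hM : ∀ n : ℕ, Real.log (n + 1) ≤ M * α n) {Λ : Set ℂ}
    (hΛ : HasPolynomialResolvent Λ) (S : Λ → E α s →ₗ[ℂ] E α s)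
    (hS : ∀ z x n, z * (S z x).1 n - cesaroSeq (S z x).1 n = x.1 n)
    {U : Set (E α s)} (hU : U ∈ 𝓝 0) :
    ∃ V ∈ 𝓝 (0 : E α s), ∀ z, ∀ x ∈ V, S z x ∈ U := by
  refine exists_nhds_of_steps hα0 hs1 hs S (fun k => ?_) hU
  obtain ⟨K, N, hK, hb⟩ := hΛ
  obtain ⟨l, hl⟩ := exists_step_of_growth hα_top hα0 hs1 hs_top hM k N
  refine ⟨l, K, fun z x => ?_⟩
  -- The natural majorant of an element of a step is monotone, which is why `HasPolynomialResolvent`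
  -- needs only monotone `B`.
  have hmono : Monotone fun n => ‖x‖ * (weight α s k n)⁻¹ := fun m n hmn =>
    mul_le_mul_of_nonneg_left
      (inv_anti₀ (weight_pos hs1 k n) (weight_antitone hα hs1 k hmn)) (norm_nonneg x)
  obtain ⟨hmem, hle⟩ := hl (K * ‖x‖) (S z (incl α s k x)).1 (mul_nonneg hK (norm_nonneg _))
    fun n => (hb z z.2 _ _ _ hmono (x.coord_le hs1) (hS z (incl α s k x)) n).trans_eq (by ring)
  exact ⟨⟨_, hmem⟩, rfl, C0.norm_le _ hle⟩

/-- The points `z`, not of the form `1 / (n + 1)`, at which the resolvent has polynomial growth,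
belong to the resolvent set. -/
theorem mem_resolventSet_cesaro (hα0 : ∀ n, 0 < α n) (hα : StrictMono α)
    (hα_top : Tendsto α atTop atTop) (hs1 : ∀ k, 1 < s k) (hs : StrictMono s)
    (hs_top : Tendsto s atTop atTop) (hM : ∀ n : ℕ, Real.log (n + 1) ≤ M * α n) {z : ℂ}
    (hΛ : HasPolynomialResolvent {z}) (hz : ∀ n : ℕ, z ≠ 1 / ((n : ℂ) + 1)) :
    z ∈ resolventSet ℂ (cesaro α s hα hs1) := by
  set T := algebraMap ℂ (E α s →L[ℂ] E α s) z - cesaro α s hα hs1 with hTdef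
  have hT : ∀ x n, (T x).1 n = z * x.1 n - cesaroSeq x.1 n := fun x n => rfl
  have hinj : Function.Injective T := by
    rw [injective_iff_map_eq_zero]
    intro x hx
    obtain ⟨K, N, -, hb⟩ := hΛ
    have h0 : ∀ n, z * x.1 n - cesaroSeq x.1 n = 0 := fun n => by rw [← hT, hx]; rfl
    refine Subtype.ext (funext fun n => ?_)
    -- The growth bound with `B = 0` forces a kernel vector to vanish.
    have h := hb z rfl x.1 (fun _ => 0) (fun _ => 0) monotone_const (by simp) h0 n
    simp only [mul_zero] at h
    exact norm_le_zero_iff.1 h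
  have hsurj : Function.Surjective T := by
    intro y
    obtain ⟨k, y, rfl⟩ := exists_incl_eq hα0 hs1 hs y
    obtain ⟨x, hx⟩ := exists_resolvent_solution hz y.1
    obtain ⟨K, N, hK, hb⟩ := hΛ
    obtain ⟨l, hl⟩ := exists_step_of_growth hα_top hα0 hs1 hs_top hM k N
    have hmono : Monotone fun n => ‖y‖ * (weight α s k n)⁻¹ := fun m n hmn =>
      mul_le_mul_of_nonneg_left
        (inv_anti₀ (weight_pos hs1 k n) (weight_antitone hα hs1 k hmn)) (norm_nonneg y)
    obtain ⟨hmem, -⟩ := hl (K * ‖y‖) x (mul_nonneg hK (norm_nonneg _))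
      fun n => (hb z rfl _ _ _ hmono (y.coord_le hs1) hx n).trans_eq (by ring)
    exact ⟨incl α s l ⟨x, hmem⟩, Subtype.ext (funext hx)⟩
  let e : E α s ≃ₗ[ℂ] E α s := LinearEquiv.ofBijective (T : E α s →ₗ[ℂ] E α s) ⟨hinj, hsurj⟩
  have he : ∀ x, T (e.symm x) = x := fun x => e.apply_symm_apply x
  have he' : ∀ x, e.symm (T x) = x := fun x => e.symm_apply_apply x
  -- The step estimates for `Λ = {z}` give continuity of the inverse directly, without an open
  -- mapping theorem.
  have hcont : Continuous e.symm := by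
    refine continuous_of_continuousAt_zero e.symm ?_
    rw [ContinuousAt, map_zero]
    intro U hU
    obtain ⟨V, hV, hVU⟩ := exists_nhds_of_solutions hα0 hα hα_top hs1 hs hs_top hM hΛ
      (fun _ => (e.symm : E α s →ₗ[ℂ] E α s)) (by
        rintro ⟨_, rfl⟩ x n
        rw [← hT]
        exact congrArg (fun v : E α s => v.1 n) (he x)) hU
    exact mem_map.2 <| mem_of_superset hV fun x hx => hVU ⟨z, rfl⟩ x hx
  let R : E α s →L[ℂ] E α s := ⟨e.symm, hcont⟩
  rw [spectrum.mem_resolventSet_iff, ← hTdef]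
  exact ⟨⟨T, R, ContinuousLinearMap.ext he, ContinuousLinearMap.ext he'⟩, rfl⟩

/-- `resolvent` is a `Ring.inverse`, which is a genuine inverse on the resolvent set, so the
resolvents solve the equations required by `exists_nhds_of_solutions`. -/
theorem isEquicontinuousSet_resolvent (hα0 : ∀ n, 0 < α n) (hα : StrictMono α)
    (hα_top : Tendsto α atTop atTop) (hs1 : ∀ k, 1 < s k) (hs : StrictMono s)
    (hs_top : Tendsto s atTop atTop) (hM : ∀ n : ℕ, Real.log (n + 1) ≤ M * α n) {Λ : Set ℂ}
    (hΛ : HasPolynomialResolvent Λ) (hΛ' : Λ ⊆ resolventSet ℂ (cesaro α s hα hs1)) :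
    IsEquicontinuousSet ((fun μ => resolvent (cesaro α s hα hs1) μ) '' Λ) := by
  intro U hU
  obtain ⟨V, hV, hVU⟩ := exists_nhds_of_solutions hα0 hα hα_top hs1 hs hs_top hM hΛ
    (fun z => ContinuousLinearMap.toLinearMap (resolvent (cesaro α s hα hs1) (z : ℂ))) (by
      rintro ⟨z, hz⟩ x n
      have h := Ring.mul_inverse_cancel _ (spectrum.mem_resolventSet_iff.1 (hΛ' hz))
      exact congrArg (fun A : E α s →L[ℂ] E α s => (A x).1 n) h) hU
  refine ⟨V, hV, ?_⟩
  rintro _ ⟨z, hz, rfl⟩ x hx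
  exact hVU ⟨z, hz⟩ x hx

/-- The sequence of binomial coefficients `n ↦ C(n, m)` is an eigenvector of the Cesàro operator
for the eigenvalue `1 / (m + 1)`. -/
theorem cesaroSeq_choose (m n : ℕ) :
    cesaroSeq (fun i => (i.choose m : ℂ)) n = 1 / ((m : ℂ) + 1) * (n.choose m : ℂ) := by
  have h1 : ∑ i ∈ Finset.range (n + 1), i.choose m = (n + 1).choose (m + 1) := by
    induction n with
    | zero => simp [Nat.choose_succ_succ]
    | succ n ih => rw [Finset.sum_range_succ, ih, Nat.choose_succ_succ (n + 1), add_comm]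
  have h2 : (n + 1) * n.choose m = (n + 1).choose (m + 1) * (m + 1) :=
    Nat.add_one_mul_choose_eq n m
  rw [cesaroSeq_apply, ← Nat.cast_sum, h1]
  have h3 : ((n : ℂ) + 1) * n.choose m = (n + 1).choose (m + 1) * ((m : ℂ) + 1) := by
    exact_mod_cast h2
  have hn : (n : ℂ) + 1 ≠ 0 := Nat.cast_add_one_ne_zero n
  have hm : (m : ℂ) + 1 ≠ 0 := Nat.cast_add_one_ne_zero m
  field_simp
  linear_combination -h3

/-- The eigenvector `n ↦ C(n, m)` is bounded by `(n + 1) ^ m`, so it lies in some step; its entry at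
`n = m` is `1`, so it is not zero. -/
theorem mem_pointSpectrum_cesaro (hα0 : ∀ n, 0 < α n) (hα : StrictMono α)
    (hα_top : Tendsto α atTop atTop) (hs1 : ∀ k, 1 < s k)
    (hs_top : Tendsto s atTop atTop) (hM : ∀ n : ℕ, Real.log (n + 1) ≤ M * α n) (m : ℕ) :
    1 / ((m : ℂ) + 1) ∈ pointSpectrum (cesaro α s hα hs1) := by
  obtain ⟨l, hl⟩ := exists_step_of_growth hα_top hα0 hs1 hs_top hM 0 m
  obtain ⟨hmem, -⟩ := hl 1 (fun i => (i.choose m : ℂ)) zero_le_one fun n => by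
    rw [Complex.norm_natCast, one_mul]
    have h1 : (n.choose m : ℝ) ≤ (n + 1 : ℝ) ^ m := by
      exact_mod_cast (Nat.choose_le_pow n m).trans (Nat.pow_le_pow_left n.le_succ m)
    refine h1.trans (le_mul_of_one_le_right (by positivity) ?_)
    exact (one_le_inv₀ (weight_pos hs1 0 n)).2 (weight_le_one hα0 hs1 0 n)
  intro hinj
  have h0 : incl α s l ⟨_, hmem⟩ = 0 := by
    refine hinj ?_
    rw [map_zero]
    exact Subtype.ext (funext fun n => sub_eq_zero.2 (cesaroSeq_choose m n).symm)
  have h1 : ((m.choose m : ℕ) : ℂ) = 0 := congrArg (fun v : E α s => v.1 m) h0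
  simp at h1

end Resolvent

theorem pointSpectrum_subset_spectrum {X : Type*} [AddCommGroup X] [Module ℂ X]
    [TopologicalSpace X] [IsTopologicalAddGroup X] [ContinuousSMul ℂ X] (T : X →L[ℂ] X) :
    pointSpectrum T ⊆ spectrum ℂ T := by
  intro z hz hu
  obtain ⟨v, hv⟩ := spectrum.mem_resolventSet_iff.1 hu
  refine hz fun x y hxy => ?_
  have h : (v : X →L[ℂ] X) x = (v : X →L[ℂ] X) y := by rw [hv]; exact hxy
  have hinv : ∀ x, (↑v⁻¹ : X →L[ℂ] X) ((v : X →L[ℂ] X) x) = x := fun x =>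
    congrArg (fun A : X →L[ℂ] X => A x) v.inv_mul
  rw [← hinv x, h, hinv]

theorem spectrum_subset_spectrumStar {X : Type*} [AddCommGroup X] [Module ℂ X]
    [TopologicalSpace X] [IsTopologicalAddGroup X] [ContinuousSMul ℂ X] (T : X →L[ℂ] X) :
    spectrum ℂ T ⊆ spectrumStar T := by
  rintro z hz ⟨δ, hδ, hball, -⟩
  exact hz (hball (Metric.mem_ball_self hδ))

theorem setOf_one_div_eq_range :
    {z : ℂ | ∃ n : ℕ, 1 ≤ n ∧ z = 1 / (n : ℂ)} = Set.range fun m : ℕ => 1 / ((m : ℂ) + 1) := by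
  ext z
  constructor
  · rintro ⟨n, hn, rfl⟩
    obtain ⟨m, rfl⟩ := Nat.exists_eq_add_of_le' hn
    exact ⟨m, by push_cast; rfl⟩
  · rintro ⟨m, rfl⟩
    exact ⟨m + 1, by omega, by push_cast; rfl⟩

end CesaroSpec

/-! ### The main theorem -/

theorem proposition2p9 (α s : ℕ → ℝ)
    (hα0 : ∀ n, 0 < α n) (hα : StrictMono α) (hα_top : Filter.Tendsto α Filter.atTop Filter.atTop)
    (hs1 : ∀ k, 1 < s k) (hs : StrictMono s) (hs_top : Filter.Tendsto s Filter.atTop Filter.atTop)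
    (hnuc : CesaroSpec.IsNuclearSpace (CesaroSpec.E α s)) :
    (spectrum ℂ (CesaroSpec.cesaro α s hα hs1) =
        CesaroSpec.pointSpectrum (CesaroSpec.cesaro α s hα hs1) ∧
      CesaroSpec.pointSpectrum (CesaroSpec.cesaro α s hα hs1) =
        {z : ℂ | ∃ n : ℕ, 1 ≤ n ∧ z = 1 / (n : ℂ)}) ∧
    (CesaroSpec.spectrumStar (CesaroSpec.cesaro α s hα hs1) =
        spectrum ℂ (CesaroSpec.cesaro α s hα hs1) ∪ {0} ∧
      CesaroSpec.spectrumStar (CesaroSpec.cesaro α s hα hs1) =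
        {0} ∪ {z : ℂ | ∃ n : ℕ, 1 ≤ n ∧ z = 1 / (n : ℂ)}) := by
  obtain ⟨M, hM⟩ := CesaroSpec.exists_log_le_of_nuclear hα0 hα hs1 hs hnuc
  rw [CesaroSpec.setOf_one_div_eq_range]
  set C := CesaroSpec.cesaro α s hα hs1
  set A : Set ℂ := Set.range fun m : ℕ => 1 / ((m : ℂ) + 1)
  have hA : ∀ {z : ℂ}, z ∉ A → ∀ n : ℕ, z ≠ 1 / ((n : ℂ) + 1) := fun hz n h => hz ⟨n, h.symm⟩
  have hres : ∀ {z : ℂ}, CesaroSpec.HasPolynomialResolvent {z} →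
      (∀ n : ℕ, z ≠ 1 / ((n : ℂ) + 1)) → z ∈ resolventSet ℂ C := fun h1 h2 =>
    CesaroSpec.mem_resolventSet_cesaro hα0 hα hα_top hs1 hs hs_top hM h1 h2
  have hA_pt : A ⊆ CesaroSpec.pointSpectrum C := by
    rintro _ ⟨m, rfl⟩
    exact CesaroSpec.mem_pointSpectrum_cesaro hα0 hα hα_top hs1 hs_top hM m
  have hpt_sp := CesaroSpec.pointSpectrum_subset_spectrum C
  have hstar : ∀ z, z ≠ 0 → z ∉ A → z ∈ CesaroSpec.resolventSetStar C := by
    intro z hz0 hz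
    obtain ⟨δ, hδ, hpol, hball⟩ := CesaroSpec.exists_ball_hasPolynomialResolvent hz0 (hA hz)
    have hsub : Metric.ball z δ ⊆ resolventSet ℂ C := fun μ hμ => by
      obtain ⟨K, N, hK, hb⟩ := hpol
      refine hres ⟨K, N, hK, ?_⟩ (hball μ hμ)
      rintro _ rfl
      exact hb _ hμ
    exact ⟨δ, hδ, hsub,
      CesaroSpec.isEquicontinuousSet_resolvent hα0 hα hα_top hs1 hs hs_top hM hpol hsub⟩
  have hsp_A : spectrum ℂ C ⊆ A := by
    intro z hz
    by_contra hzA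
    refine hz ?_
    rcases eq_or_ne z 0 with rfl | hz0
    · exact hres CesaroSpec.hasPolynomialResolvent_zero (hA hzA)
    · obtain ⟨δ, hδ, hball, -⟩ := hstar z hz0 hzA
      exact hball (Metric.mem_ball_self hδ)
  have hsp : spectrum ℂ C = A := hsp_A.antisymm (hA_pt.trans hpt_sp)
  have hpt : CesaroSpec.pointSpectrum C = A := (hpt_sp.trans hsp_A).antisymm hA_pt
  have hst : CesaroSpec.spectrumStar C = {0} ∪ A := by
    refine Set.Subset.antisymm (fun z hz => ?_) (Set.union_subset ?_ ?_)
    · by_contra h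
      rw [Set.mem_union, Set.mem_singleton_iff, not_or] at h
      exact hz (hstar z h.1 h.2)
    -- Every disc around `0` contains some eigenvalue `1 / (m + 1)`, so none lies in the resolvent
    -- set.
    · rintro _ rfl ⟨δ, hδ, hball, -⟩
      have hlim := tendsto_one_div_add_atTop_nhds_zero_nat (𝕜 := ℂ)
      obtain ⟨m, hm⟩ := (hlim.eventually (Metric.ball_mem_nhds 0 hδ)).exists
      exact hpt_sp (hA_pt ⟨m, rfl⟩) (hball hm)
    · exact (hA_pt.trans hpt_sp).trans (CesaroSpec.spectrum_subset_spectrumStar C)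
  rw [hst, hsp, hpt, Set.union_comm]
  exact ⟨⟨rfl, rfl⟩, rfl, rfl⟩
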